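/- Let $d\ge 2$ and let $K\subset\mathbb{R}^d$ be a convex body of class $\mathcal{C}^2_+$, that is, a compact convex set with non-empty interior whose boundary $\partial K$ is a twice continuously differentiable hypersurface with everywhere positive Gaussian curvature. For $n\in\mathbb{N}$ let $X_1,\dots,X_n$ be independent random points uniformly distributed on $\partial K$ (with respect to the normalized $(d-1)$-dimensional Hausdorff measure on $\partial K$), and put $\mathcal{X}_n=\{X_1,\dots,X_n\}$. For a finite set $\mathcal{X}\subset\partial K$ and $x\in\partial K$, let $[\mathcal{X},x]$ be the convex hull of $\mathcal{X}\cup\{x\}$, and define $$R(x,\mathcal{X}\cup\{x\})=\inf\bigl\{R>0 : K\cap H_F^+\subset B(x,R)\ \text{for all facets } F \text{ of } [\mathcal{X},x] \text{ with } x\in F\bigr\},$$ where facets are the $(d-1)$-dimensional faces, $B(x,R)$ is the Euclidean ball with center $x$ and radius $R$, and $H_F^+$ is the closed half-space bounded by the affine hull $H_F$ of $F$ that meets $[\mathcal{X},x]$ only in $H_F$. (If $[\mathcal{X},x]$ itself has dimension $d-1$, it counts as its own facet, and both half-spaces bounded by its affine hull are taken into account.) Then there exist constants $c,C>0$, depending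 only on $K$ (and $d$), such that for all $x\in\partial K$, all $r>0$ and all $n\in\mathbb{N}$, $$\mathbb{P}\bigl(R(x,\mathcal{X}_n\cup\{x\})\ge r\bigr)\le C\exp\bigl(-c\,r^{d-1}n\bigr).$$ -/

import Mathlib

open MeasureTheory ProbabilityTheory
open scoped Topology RealInnerProductSpace

noncomputable section

/-! Smooth convex bodies of class `C²₊`. -/

/-- `f` is a `C²` defining function of the set `K` near the point `x`: it is twice continuously
differentiable near `x`, its gradient at `x` does not vanish, and near `x` the set `K` is the
sublevel set `{f ≤ 0}`. (For `x ∈ ∂K`, the boundary of `K` near `x` is then the regular level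
surface `{f = 0}`, and `∇f` is an outward normal field of it.) -/
structure IsDefiningFunctionAt {d : ℕ} (K : Set (EuclideanSpace ℝ (Fin d)))
    (f : EuclideanSpace ℝ (Fin d) → ℝ) (x : EuclideanSpace ℝ (Fin d)) : Prop where
  contDiffAt : ContDiffAt ℝ 2 f x
  gradient_ne_zero : gradient f x ≠ 0
  eventually_mem_iff : ∀ᶠ y in 𝓝 x, y ∈ K ↔ f y ≤ 0

/-- The unit normal field `∇f / ‖∇f‖` of the level surfaces of `f`. -/
def unitNormal {d : ℕ} (f : EuclideanSpace ℝ (Fin d) → ℝ) (y : EuclideanSpace ℝ (Fin d)) :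
    EuclideanSpace ℝ (Fin d) :=
  ‖gradient f y‖⁻¹ • gradient f y

/-- The tangent space at `x` of the level surface of `f` through `x`. -/
abbrev levelTangent {d : ℕ} (f : EuclideanSpace ℝ (Fin d) → ℝ) (x : EuclideanSpace ℝ (Fin d)) :
    Submodule ℝ (EuclideanSpace ℝ (Fin d)) :=
  (Submodule.span ℝ {gradient f x})ᗮ

/-- The Weingarten map (shape operator) at `x` of the level surface of `f` through `x`: the
differential of the unit normal field, as an endomorphism of the tangent space. (The differential
maps tangent vectors to tangent vectors, because the normal field has length one; the projection
only adjusts the codomain.) Its eigenvalues are the principal curvatures; they are nonnegative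
for the boundary of a convex set `{f ≤ 0}`. -/
def weingartenMap {d : ℕ} (f : EuclideanSpace ℝ (Fin d) → ℝ) (x : EuclideanSpace ℝ (Fin d)) :
    levelTangent f x →L[ℝ] levelTangent f x :=
  (levelTangent f x).orthogonalProjectionOnto ∘L fderiv ℝ (unitNormal f) x ∘L
    (levelTangent f x).subtypeL

/-- The Gaussian curvature at `x` of the level surface of `f` through `x`: the product of the
principal curvatures, that is, the determinant of the Weingarten map. -/
def gaussianCurvature {d : ℕ} (f : EuclideanSpace ℝ (Fin d) → ℝ)
    (x : EuclideanSpace ℝ (Fin d)) : ℝ :=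
  LinearMap.det (weingartenMap f x : levelTangent f x →ₗ[ℝ] levelTangent f x)

/-- The class `C²₊`: full-dimensional convex bodies whose boundary is twice continuously
differentiable with Gaussian curvature positive everywhere. (The Gaussian curvature of `∂K` at `x`
does not depend on the choice of the defining function.) -/
def IsC2Plus {d : ℕ} (K : ConvexBody (EuclideanSpace ℝ (Fin d))) : Prop :=
  (interior (K : Set (EuclideanSpace ℝ (Fin d)))).Nonempty ∧
    ∀ x ∈ frontier (K : Set (EuclideanSpace ℝ (Fin d))),
      ∃ f : EuclideanSpace ℝ (Fin d) → ℝ,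
        IsDefiningFunctionAt (K : Set (EuclideanSpace ℝ (Fin d))) f x ∧ 0 < gaussianCurvature f x

/-- The uniform distribution on `∂K`: the `(d-1)`-dimensional Hausdorff measure restricted to `∂K`
and normalized to total mass one. -/
def boundaryUniform {d : ℕ} (K : ConvexBody (EuclideanSpace ℝ (Fin d))) :
    Measure (EuclideanSpace ℝ (Fin d)) :=
  ProbabilityTheory.cond (Measure.hausdorffMeasure ((d : ℝ) - 1))
    (frontier (K : Set (EuclideanSpace ℝ (Fin d))))

/-! Faces of polytopes and the radius of stabilization. -/

/-- The set of `k`-dimensional faces of a polytope `P` (intersections with supporting hyperplanes,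
and `P` itself if it has dimension `k`). -/
def polytopeFaces {d : ℕ} (k : ℕ) (P : Set (EuclideanSpace ℝ (Fin d))) :
    Set (Set (EuclideanSpace ℝ (Fin d))) :=
  {F | F.Nonempty ∧ IsExposed ℝ P F ∧ Module.finrank ℝ (vectorSpan ℝ F) = k}

/-- `H` is a half-space `H_F^+` of the facet `F` of `P`: a closed half-space bounded by the affine
hull of `F` that meets `P` only in its bounding hyperplane. (It is unique when `P` is
full-dimensional.) -/
def IsFacetHalfspace {d : ℕ} (P F H : Set (EuclideanSpace ℝ (Fin d))) : Prop :=
  ∃ (u : EuclideanSpace ℝ (Fin d)) (t : ℝ), u ≠ 0 ∧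
    H = {z | t ≤ ⟪u, z⟫} ∧
    (affineSpan ℝ F : Set (EuclideanSpace ℝ (Fin d))) = {z | ⟪u, z⟫ = t} ∧
    P ∩ H ⊆ {z | ⟪u, z⟫ = t}

/-- The radius of stabilization `R(x, A)` for a finite set `A` that contains `x`: the infimum of
the radii `R > 0` such that `K ∩ H_F^+ ⊆ B(x, R)` for all facets `F` of the convex hull of `A`
with `x ∈ F`. -/
def stabilizationRadius {d : ℕ} (K : ConvexBody (EuclideanSpace ℝ (Fin d)))
    (x : EuclideanSpace ℝ (Fin d)) (A : Set (EuclideanSpace ℝ (Fin d))) : ℝ :=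
  sInf {R : ℝ | 0 < R ∧ ∀ F ∈ polytopeFaces (d - 1) (convexHull ℝ A), x ∈ F →
    ∀ H, IsFacetHalfspace (convexHull ℝ A) F H →
      (K : Set (EuclideanSpace ℝ (Fin d))) ∩ H ⊆ Metric.closedBall x R}

end

/-!
A half-space `H` with `x` on its boundary hyperplane that comes from a facet at `x` contains no
sample point in its interior. If the radius of stabilization is at least `r`, one such `H` cuts off
from `K` a cap that reaches farther than `r / 2` from `x`, so it suffices that large empty caps
through `x` are exponentially unlikely.

*Geometry.* Near a boundary point, adding a multiple of `f ^ 2` to a defining function `f` gives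
a positive definite Hessian: convexity makes the second fundamental form positive semidefinite, and
the positive determinant makes it definite. Taylor's formula and compactness turn this into
`a * ‖y - z‖ ^ 2 ≤ ⟪u, z - y⟫ ≤ b * ‖y - z‖ ^ 2` for all boundary points `z` with outer unit normal
`u` and all boundary points `y`, the lower bound being valid on all of `K`
(`exists_normal_bounds`). If a cap through `x` has height `h`, attained at `z`, the lower bound
confines it to distance `s = √(h / a)` from `z`, while the upper bound puts all boundary points
within distance `q * s` of `z` into its interior (`exists_ball_inter_frontier_subset_cap`).

*Measure.* Boundary balls of radius `δ` have `(d - 1)`-dimensional measure at least of order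
`δ ^ (d - 1)`, as seen by projecting along a normal, and the whole boundary has finite measure,
because it is a finite union of Lipschitz graphs.

*Probability.* The point `z` is unknown, but `‖z - x‖ ≤ s`, so that for `s` of dyadic order
`2 ^ k * r` it is close to one of a fixed number `N` of points of a net (`exists_detecting_balls`).
A union bound over the net and over `k` gives
`∑ k, N * exp (-c * (2 ^ k * r) ^ (d - 1) * n)`, which is dominated by its first term as soon as
`c * r ^ (d - 1) * n ≥ 1`; otherwise the claim is trivial.
-/

/-! ### Second-order Taylor estimates -/

section Taylor

variable {E : Type*} [NormedAddCommGroup E] [NormedSpace ℝ E]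

theorem taylor_lower_bound_unitInterval {φ φ' φ'' : ℝ → ℝ} {m : ℝ}
    (h1 : ∀ t ∈ Set.Icc (0 : ℝ) 1, HasDerivAt φ (φ' t) t)
    (h2 : ∀ t ∈ Set.Icc (0 : ℝ) 1, HasDerivAt φ' (φ'' t) t)
    (hm : ∀ t ∈ Set.Icc (0 : ℝ) 1, m ≤ φ'' t) :
    φ 0 + φ' 0 + m / 2 ≤ φ 1 := by
  have hsub : ∀ t ∈ Set.Ico (0 : ℝ) 1, t ∈ Set.Icc (0 : ℝ) 1 := fun t ht => ⟨ht.1, ht.2.le⟩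
  have hd1 : ∀ t : ℝ, HasDerivAt (fun t => φ' 0 + m * t) m t := fun t => by
    simpa using ((hasDerivAt_id t).const_mul m).const_add (φ' 0)
  have hd2 : ∀ t : ℝ, HasDerivAt (fun t => φ 0 + φ' 0 * t + m * t ^ 2 / 2) (φ' 0 + m * t) t :=
    fun t => by
      have h := (((hasDerivAt_id t).const_mul (φ' 0)).const_add (φ 0)).add
        ((((hasDerivAt_id t).pow 2).const_mul m).div_const 2)
      refine h.congr_deriv ?_
      simp; ring
  have key : ∀ t ∈ Set.Icc (0 : ℝ) 1, φ' 0 + m * t ≤ φ' t := by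
    intro t ht
    exact image_le_of_deriv_right_le_deriv_boundary
      (fun t _ => (hd1 t).continuousAt.continuousWithinAt)
      (fun t _ => (hd1 t).hasDerivWithinAt) (by simp)
      (fun t ht => (h2 t ht).continuousAt.continuousWithinAt)
      (fun t ht => (h2 t (hsub t ht)).hasDerivWithinAt) (fun t ht => hm t (hsub t ht)) ht
  have := image_le_of_deriv_right_le_deriv_boundary
      (fun t _ => (hd2 t).continuousAt.continuousWithinAt)
      (fun t _ => (hd2 t).hasDerivWithinAt) (by simp)
      (fun t ht => (h1 t ht).continuousAt.continuousWithinAt)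
      (fun t ht => (h1 t (hsub t ht)).hasDerivWithinAt) (fun t ht => key t (hsub t ht))
      (Set.right_mem_Icc.2 zero_le_one)
  simpa using this

theorem taylor_lower_bound_segment {g : E → ℝ} {z y : E} {m : ℝ}
    (hg : ∀ w ∈ segment ℝ z y, ContDiffAt ℝ 2 g w)
    (hm : ∀ w ∈ segment ℝ z y, m ≤ fderiv ℝ (fderiv ℝ g) w (y - z) (y - z)) :
    g z + fderiv ℝ g z (y - z) + m / 2 ≤ g y := by
  have hseg : ∀ t ∈ Set.Icc (0 : ℝ) 1, z + t • (y - z) ∈ segment ℝ z y := by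
    intro t ht
    rw [segment_eq_image']
    exact ⟨t, ht, rfl⟩
  have hl : ∀ t : ℝ, HasDerivAt (fun t : ℝ => z + t • (y - z)) (y - z) t := fun t => by
    simpa using ((hasDerivAt_id t).smul_const (y - z)).const_add z
  have h := taylor_lower_bound_unitInterval (φ := fun t : ℝ => g (z + t • (y - z)))
    (φ' := fun t : ℝ => fderiv ℝ g (z + t • (y - z)) (y - z))
    (φ'' := fun t : ℝ => fderiv ℝ (fderiv ℝ g) (z + t • (y - z)) (y - z) (y - z)) (m := m)
    (fun t ht => ((hg _ (hseg t ht)).differentiableAt (by norm_num)).hasFDerivAt.comp_hasDerivAt t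
      (hl t))
    (fun t ht => by
      have h2 : DifferentiableAt ℝ (fderiv ℝ g) (z + t • (y - z)) :=
        ((hg _ (hseg t ht)).fderiv_right (m := 1) (by norm_num)).differentiableAt (by norm_num)
      have h3 := h2.hasFDerivAt.comp_hasDerivAt t (hl t)
      simpa using h3.clm_apply (hasDerivAt_const t (y - z)))
    (fun t ht => hm _ (hseg t ht))
  simpa using h

theorem taylor_upper_bound_segment {g : E → ℝ} {z y : E} {m : ℝ}
    (hg : ∀ w ∈ segment ℝ z y, ContDiffAt ℝ 2 g w)
    (hm : ∀ w ∈ segment ℝ z y, fderiv ℝ (fderiv ℝ g) w (y - z) (y - z) ≤ m) :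
    g y ≤ g z + fderiv ℝ g z (y - z) + m / 2 := by
  have h1 : fderiv ℝ (fun x => -g x) = fun x => -fderiv ℝ g x := by
    ext1 x; exact fderiv_fun_neg
  have h := taylor_lower_bound_segment (g := fun x => -g x) (z := z) (y := y) (m := -m)
    (fun w hw => (hg w hw).neg) (fun w hw => by
      rw [h1, fderiv_fun_neg]
      exact neg_le_neg (hm w hw))
  rw [h1] at h
  simp only [neg_apply] at h
  linarith

theorem ContDiffAt.eventually_norm_fderiv_fderiv_sub_lt {g : E → ℝ} {x : E}
    (hg : ContDiffAt ℝ 2 g x) {ε : ℝ} (hε : 0 < ε) :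
    ∀ᶠ y in 𝓝 x, ‖fderiv ℝ (fderiv ℝ g) y - fderiv ℝ (fderiv ℝ g) x‖ < ε := by
  have hc : ContinuousAt (fderiv ℝ (fderiv ℝ g)) x :=
    ((hg.fderiv_right (m := 1) (by norm_num)).fderiv_right (m := 0) (by norm_num)).continuousAt
  have hn : ContinuousAt (fun y => ‖fderiv ℝ (fderiv ℝ g) y - fderiv ℝ (fderiv ℝ g) x‖) x :=
    ContinuousAt.norm (E := E →L[ℝ] E →L[ℝ] ℝ)
      (ContinuousAt.sub (f := fderiv ℝ (fderiv ℝ g)) hc continuousAt_const)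
  have h0 : ‖fderiv ℝ (fderiv ℝ g) x - fderiv ℝ (fderiv ℝ g) x‖ < ε := by
    rw [sub_self (fderiv ℝ (fderiv ℝ g) x), norm_zero (E := E →L[ℝ] E →L[ℝ] ℝ)]
    exact hε
  exact hn.eventually_lt continuousAt_const h0

end Taylor

/-! ### Convex bodies and their outer normals -/

section ConvexBodies

variable {d : ℕ}

local notation "𝔼" => EuclideanSpace ℝ (Fin d)

/-- `u` is an outer unit normal of `K` at `z`. -/
def IsOuterUnitNormal (K : Set (EuclideanSpace ℝ (Fin d))) (z u : EuclideanSpace ℝ (Fin d)) :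
    Prop :=
  ‖u‖ = 1 ∧ ∀ y ∈ K, ⟪u, y⟫ ≤ ⟪u, z⟫

theorem exists_isOuterUnitNormal {K : Set 𝔼} (hc : Convex ℝ K) (hi : (interior K).Nonempty)
    {z : 𝔼} (hz : z ∈ frontier K) : ∃ u, IsOuterUnitNormal K z u := by
  obtain ⟨o, ho⟩ := hi
  obtain ⟨f, hf⟩ := geometric_hahn_banach_open_point hc.interior isOpen_interior hz.2
  set v := (InnerProductSpace.toDual ℝ 𝔼).symm f with hv
  have hfv : ∀ y, ⟪v, y⟫ = f y := fun y => by simp [hv]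
  have hv0 : v ≠ 0 := by
    intro h0
    have := hf o ho
    rw [← hfv, ← hfv, h0] at this
    simp at this
  have hle : ∀ y ∈ K, ⟪v, y⟫ ≤ ⟪v, z⟫ := by
    intro y hy
    have hcl : y ∈ closure (interior K) := by
      rw [hc.closure_interior_eq_closure_of_nonempty_interior ⟨o, ho⟩]
      exact subset_closure hy
    have hclosed : IsClosed {y : 𝔼 | ⟪v, y⟫ ≤ ⟪v, z⟫} :=
      isClosed_le (by fun_prop) continuous_const
    refine closure_minimal (fun y hy => ?_) hclosed hcl
    have := (hf y hy).le
    rwa [← hfv, ← hfv] at this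
  refine ⟨‖v‖⁻¹ • v, ?_, fun y hy => ?_⟩
  · rw [norm_smul, norm_inv, norm_norm, inv_mul_cancel₀ (norm_ne_zero_iff.2 hv0)]
  · rw [inner_smul_left, inner_smul_left]
    exact mul_le_mul_of_nonneg_left (hle y hy) (by simp)

theorem IsOuterUnitNormal.notMem_interior {K : Set 𝔼} {z u : 𝔼} (hu : IsOuterUnitNormal K z u) :
    z ∉ interior K := by
  intro hz
  obtain ⟨ε, hε, hb⟩ := Metric.mem_nhds_iff.1 (mem_interior_iff_mem_nhds.1 hz)
  have hmem : z + (ε / 2) • u ∈ K := hb (by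
    rw [Metric.mem_ball, dist_eq_norm, add_sub_cancel_left, norm_smul, hu.1, Real.norm_eq_abs,
      abs_of_pos (half_pos hε)]
    linarith)
  have := hu.2 _ hmem
  rw [inner_add_right, inner_smul_right, real_inner_self_eq_norm_sq, hu.1] at this
  linarith

/-! ### The second fundamental form of a boundary of positive curvature -/

theorem fderiv_gradient_inner {f : 𝔼 → ℝ} {x : 𝔼} (hf : ContDiffAt ℝ 2 f x) :
    DifferentiableAt ℝ (gradient f) x ∧
      ∀ v w, ⟪fderiv ℝ (gradient f) x v, w⟫ = fderiv ℝ (fderiv ℝ f) x v w := by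
  have hd : DifferentiableAt ℝ (fderiv ℝ f) x :=
    (hf.fderiv_right (m := 1) (by norm_num)).differentiableAt (by norm_num)
  let J : (𝔼 →L[ℝ] ℝ) →L[ℝ] 𝔼 := LinearMap.mkContinuous
    { toFun := fun l => (InnerProductSpace.toDual ℝ 𝔼).symm l
      map_add' := fun a b => map_add _ a b
      map_smul' := fun c a => by simp } 1 (fun l => by simp)
  have hJ : HasFDerivAt (gradient f) (J ∘L fderiv ℝ (fderiv ℝ f) x) x :=
    J.hasFDerivAt.comp x hd.hasFDerivAt
  refine ⟨hJ.differentiableAt, fun v w => ?_⟩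
  rw [hJ.fderiv]
  change ⟪(InnerProductSpace.toDual ℝ 𝔼).symm (fderiv ℝ (fderiv ℝ f) x v), w⟫ = _
  simp

/-- The second fundamental form is the Hessian of the defining function, restricted to the tangent
space and divided by the length of the gradient: the derivative of the factor `‖∇f‖⁻¹` only
contributes a normal component. -/
theorem inner_weingartenMap {f : 𝔼 → ℝ} {x : 𝔼} (hf : ContDiffAt ℝ 2 f x)
    (h0 : gradient f x ≠ 0) (v w : levelTangent f x) :
    ⟪weingartenMap f x v, w⟫ = ‖gradient f x‖⁻¹ * fderiv ℝ (fderiv ℝ f) x v w := by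
  obtain ⟨hd, hin⟩ := fderiv_gradient_inner hf
  have hn : DifferentiableAt ℝ (fun y => ‖gradient f y‖⁻¹) x :=
    (hd.norm ℝ h0).inv (norm_ne_zero_iff.2 h0)
  have hD := hn.hasFDerivAt.smul hd.hasFDerivAt
  have hfd : fderiv ℝ (unitNormal f) x = _ := HasFDerivAt.fderiv hD
  have hw : ⟪gradient f x, (w : 𝔼)⟫ = 0 :=
    (Submodule.mem_orthogonal _ _).1 w.2 _ (Submodule.mem_span_singleton_self _)
  rw [real_inner_comm]
  simp only [weingartenMap, ContinuousLinearMap.comp_apply, Submodule.subtypeL_apply]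
  rw [Submodule.inner_orthogonalProjectionOnto_eq_of_mem_left, hfd, real_inner_comm]
  simp only [add_apply, smul_apply,
    ContinuousLinearMap.smulRight_apply, inner_add_left, real_inner_smul_left, hw, hin]
  ring

theorem mem_of_mem_segment_ball {z y x : 𝔼} {ε : ℝ} (hz : z ∈ Metric.ball x ε)
    (hy : y ∈ Metric.ball x ε) {w : 𝔼} (hw : w ∈ segment ℝ z y) : w ∈ Metric.ball x ε :=
  (convex_ball x ε).segment_subset hz hy hw

/-- On a convex sublevel set, a tangent direction of negative second derivative would place the
boundary point strictly between two interior points. -/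
theorem fderiv_fderiv_nonneg_of_tangent {K : Set 𝔼} (hc : Convex ℝ K) {f : 𝔼 → ℝ} {x : 𝔼}
    (hf : IsDefiningFunctionAt K f x) (hx : x ∈ frontier K) (hx0 : f x = 0) {v : 𝔼}
    (hv : fderiv ℝ f x v = 0) : 0 ≤ fderiv ℝ (fderiv ℝ f) x v v := by
  by_contra! hneg
  have hcont : ContinuousAt (fun y => fderiv ℝ (fderiv ℝ f) y v v) x := by
    have : ContinuousAt (fderiv ℝ (fderiv ℝ f)) x :=
      ((hf.contDiffAt.fderiv_right (m := 1) (by norm_num)).fderiv_right (m := 0)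
        (by norm_num)).continuousAt
    fun_prop
  set a := fderiv ℝ (fderiv ℝ f) x v v with ha
  have hev : ∀ᶠ y in 𝓝 x, fderiv ℝ (fderiv ℝ f) y v v < a / 2 :=
    hcont.eventually_lt continuousAt_const (by linarith)
  obtain ⟨ε, hε, hball⟩ := Metric.eventually_nhds_iff_ball.1
    (hev.and ((hf.contDiffAt.eventually (by simp)).and hf.eventually_mem_iff))
  have hint : ∀ t : ℝ, t ≠ 0 → ‖t • v‖ < ε → x + t • v ∈ interior K := by
    intro t ht htv
    have hxm : x ∈ Metric.ball x ε := Metric.mem_ball_self hε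
    have hym : x + t • v ∈ Metric.ball x ε := by simpa [Metric.mem_ball, dist_eq_norm] using htv
    have hT := taylor_upper_bound_segment (g := f) (z := x) (y := x + t • v) (m := t ^ 2 * (a / 2))
      (fun w hw => (hball w (mem_of_mem_segment_ball hxm hym hw)).2.1)
      (fun w hw => by
        have := (hball w (mem_of_mem_segment_ball hxm hym hw)).1
        simp only [add_sub_cancel_left, map_smul, smul_apply, smul_eq_mul]
        nlinarith [sq_nonneg t])
    simp only [add_sub_cancel_left, map_smul, hv, hx0, smul_zero, zero_add] at hT
    have hlt : f (x + t • v) < 0 := by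
      have : 0 < t ^ 2 := by positivity
      nlinarith
    have hfc : ContinuousAt f (x + t • v) := (hball _ hym).2.1.continuousAt
    rw [mem_interior_iff_mem_nhds]
    filter_upwards [hfc.eventually_lt continuousAt_const hlt, Metric.isOpen_ball.mem_nhds hym]
      with y hy1 hy2
    exact (hball y hy2).2.2.2 hy1.le
  set t := ε / (2 * (‖v‖ + 1)) with ht
  have htpos : 0 < t := by positivity
  have hlt : ‖t • v‖ < ε := by
    rw [norm_smul, Real.norm_eq_abs, abs_of_pos htpos, ht, div_mul_eq_mul_div,
      div_lt_iff₀ (by positivity)]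
    nlinarith [norm_nonneg v]
  have h1 := hint t htpos.ne' hlt
  have h2 := hint (-t) (neg_ne_zero.2 htpos.ne') (by simpa [norm_smul] using hlt)
  have h3 := hc.interior h1 h2 (a := 1 / 2) (b := 1 / 2) (by norm_num) (by norm_num) (by norm_num)
  refine hx.2 ?_
  convert h3 using 1
  module

/-- Positive Gaussian curvature makes the second fundamental form positive definite, since by
convexity it is positive semidefinite. -/
theorem fderiv_fderiv_pos_of_tangent {K : Set 𝔼} (hc : Convex ℝ K) {f : 𝔼 → ℝ} {x : 𝔼}
    (hf : IsDefiningFunctionAt K f x) (hx : x ∈ frontier K) (hx0 : f x = 0)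
    (hG : 0 < gaussianCurvature f x) {v : 𝔼} (hv : fderiv ℝ f x v = 0) (hv0 : v ≠ 0) :
    0 < fderiv ℝ (fderiv ℝ f) x v v := by
  have hmem : ∀ w, fderiv ℝ f x w = 0 → w ∈ levelTangent f x := by
    intro w hw
    rw [Submodule.mem_orthogonal_singleton_iff_inner_right, inner_gradient_left, hw]
  have hmem' : ∀ w : levelTangent f x, fderiv ℝ f x w = 0 := by
    intro w
    rw [← inner_gradient_left]
    exact (Submodule.mem_orthogonal_singleton_iff_inner_right).1 w.2
  have hsymm : ∀ v w, fderiv ℝ (fderiv ℝ f) x v w = fderiv ℝ (fderiv ℝ f) x w v :=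
    fun v w => (hf.contDiffAt.isSymmSndFDerivAt (by simp)).eq v w
  refine lt_of_le_of_ne (fderiv_fderiv_nonneg_of_tangent hc hf hx hx0 hv) fun h0 => ?_
  set B := fderiv ℝ (fderiv ℝ f) x with hB
  -- a null vector of a positive semidefinite form lies in its kernel
  have hker : ∀ w, fderiv ℝ f x w = 0 → B v w = 0 := by
    intro w hw
    have hq : ∀ t : ℝ, 0 ≤ B w w + 2 * t * B v w := by
      intro t
      have h := fderiv_fderiv_nonneg_of_tangent hc hf hx hx0 (v := w + t • v) (by simp [hw, hv])
      rw [← hB] at h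
      simp only [map_add, map_smul, add_apply, smul_apply,
        smul_eq_mul, ← h0, hsymm w v] at h
      linarith
    by_contra hne
    have h := hq (-(B w w + 1) / (2 * B v w))
    have h' : 2 * (-(B w w + 1) / (2 * B v w)) * B v w = -(B w w + 1) := by field_simp
    rw [h'] at h
    linarith
  have hW : weingartenMap f x ⟨v, hmem v hv⟩ = 0 := by
    apply ext_inner_right ℝ
    intro w
    rw [inner_weingartenMap hf.contDiffAt hf.gradient_ne_zero, inner_zero_left]
    simp only
    rw [← hB, hker _ (hmem' w), mul_zero]
  have hu : IsUnit (weingartenMap f x : levelTangent f x →ₗ[ℝ] levelTangent f x) := by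
    rw [LinearMap.isUnit_iff_isUnit_det]
    exact (ne_of_gt hG).isUnit
  have hinj := ((Module.End.isUnit_iff _).1 hu).1
  have : (⟨v, hmem v hv⟩ : levelTangent f x) = 0 := hinj (by simpa using hW)
  exact hv0 (by simpa using congrArg Subtype.val this)

end ConvexBodies

/-! ### Local contact of supporting hyperplanes -/

section Curvature

variable {d : ℕ}

local notation "𝔼" => EuclideanSpace ℝ (Fin d)

/-- Adding a large multiple of `f ^ 2` to a defining function `f` makes its Hessian positive
definite in all directions, not just in the tangential ones. -/
theorem exists_isDefiningFunctionAt_hessian_pos {K : Set 𝔼} (hc : Convex ℝ K) {f : 𝔼 → ℝ} {x : 𝔼}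
    (hf : IsDefiningFunctionAt K f x) (hx : x ∈ frontier K) (hx0 : f x = 0)
    (hG : 0 < gaussianCurvature f x) :
    ∃ g : 𝔼 → ℝ, IsDefiningFunctionAt K g x ∧
      ∃ m : ℝ, 0 < m ∧ ∀ v, m * ‖v‖ ^ 2 ≤ fderiv ℝ (fderiv ℝ g) x v v := by
  have hS : IsCompact (Metric.sphere (0 : 𝔼) 1) := isCompact_sphere _ _
  obtain ⟨N, hN⟩ := hS.elim_directed_cover
    (fun n : ℕ => {v : 𝔼 | 0 < fderiv ℝ (fderiv ℝ f) x v v + 2 * (n : ℝ) * (fderiv ℝ f x v) ^ 2})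
    (fun n => isOpen_lt continuous_const (by fun_prop))
    (fun v hv => by
      rw [Set.mem_iUnion]
      have hv0 : v ≠ 0 := by
        rintro rfl; simp at hv
      by_cases h0 : fderiv ℝ f x v = 0
      · exact ⟨0, by simpa [h0] using fderiv_fderiv_pos_of_tangent hc hf hx hx0 hG h0 hv0⟩
      · have hsq : 0 < (fderiv ℝ f x v) ^ 2 := by positivity
        obtain ⟨n, hn⟩ := exists_nat_gt (-fderiv ℝ (fderiv ℝ f) x v v / (fderiv ℝ f x v) ^ 2)
        refine ⟨n, ?_⟩
        rw [div_lt_iff₀ hsq] at hn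
        have : 0 ≤ (n : ℝ) * (fderiv ℝ f x v) ^ 2 := by positivity
        simp only [Set.mem_ofPred_eq]
        linarith)
    (directed_of_isDirected_le fun i j hij v hv => by
      have hij' : (i : ℝ) ≤ j := by exact_mod_cast hij
      simp only [Set.mem_ofPred_eq] at hv ⊢
      nlinarith [sq_nonneg (fderiv ℝ f x v)])
  set C := (N : ℝ) with hC
  have hdiff : ∀ᶠ y in 𝓝 x, DifferentiableAt ℝ f y :=
    (hf.contDiffAt.eventually (by simp)).mono fun y hy => hy.differentiableAt (by norm_num)
  have hfd : ∀ y, DifferentiableAt ℝ f y →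
      HasFDerivAt (fun y => f y + C * f y ^ 2) ((1 + 2 * C * f y) • fderiv ℝ f y) y := by
    intro y hy
    have h := hy.hasFDerivAt.add ((hy.hasFDerivAt.pow 2).const_mul C)
    refine h.congr_fderiv ?_
    ext w
    simp
    ring
  have hev : fderiv ℝ (fun y => f y + C * f y ^ 2) =ᶠ[𝓝 x]
      fun y => (1 + 2 * C * f y) • fderiv ℝ f y :=
    hdiff.mono fun y hy => (hfd y hy).fderiv
  have hd2 : DifferentiableAt ℝ (fderiv ℝ f) x :=
    (hf.contDiffAt.fderiv_right (m := 1) (by norm_num)).differentiableAt (by norm_num)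
  have hsec : ∀ v, fderiv ℝ (fderiv ℝ (fun y => f y + C * f y ^ 2)) x v v =
      fderiv ℝ (fderiv ℝ f) x v v + 2 * C * (fderiv ℝ f x v) ^ 2 := by
    intro v
    have h := (((hdiff.self_of_nhds.hasFDerivAt.const_mul (2 * C)).const_add 1).smul
      hd2.hasFDerivAt)
    rw [hev.fderiv_eq]
    erw [h.fderiv]
    simp [hx0]
    ring
  refine ⟨fun y => f y + C * f y ^ 2, ⟨hf.contDiffAt.add (contDiffAt_const.mul
    (hf.contDiffAt.pow 2)), ?_, ?_⟩, ?_⟩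
  · have : gradient (fun y => f y + C * f y ^ 2) x = gradient f x := by
      unfold gradient
      rw [hev.self_of_nhds]
      simp [hx0]
    rw [this]
    exact hf.gradient_ne_zero
  · have hpos : ∀ᶠ y in 𝓝 x, 0 < 1 + C * f y := by
      have hcf : ContinuousAt (fun y => 1 + C * f y) x :=
        continuousAt_const.add (continuousAt_const.mul hf.contDiffAt.continuousAt)
      exact continuousAt_const.eventually_lt hcf (by simp [hx0])
    filter_upwards [hpos, hf.eventually_mem_iff] with y hy hyK
    rw [hyK, show f y + C * f y ^ 2 = f y * (1 + C * f y) by ring]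
    constructor
    · exact fun h => mul_nonpos_of_nonpos_of_nonneg h hy.le
    · exact fun h => nonpos_of_mul_nonpos_left h hy
  · have hcontS : ContinuousOn (fun v => fderiv ℝ (fderiv ℝ f) x v v +
        2 * C * (fderiv ℝ f x v) ^ 2) (Metric.sphere (0 : 𝔼) 1) := by fun_prop
    obtain ⟨m, hm, hmS⟩ : ∃ m : ℝ, 0 < m ∧ ∀ v ∈ Metric.sphere (0 : 𝔼) 1,
        m ≤ fderiv ℝ (fderiv ℝ f) x v v + 2 * C * (fderiv ℝ f x v) ^ 2 := by
      rcases (Metric.sphere (0 : 𝔼) 1).eq_empty_or_nonempty with he | hne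
      · exact ⟨1, one_pos, fun v hv => by simp [he] at hv⟩
      · obtain ⟨v, hv, hmin⟩ := hS.exists_isMinOn hne hcontS
        exact ⟨_, hN hv, fun w hw => hmin hw⟩
    refine ⟨m, hm, fun v => ?_⟩
    rw [hsec]
    rcases eq_or_ne v 0 with rfl | hv
    · simp
    · have hn : ‖v‖ ≠ 0 := norm_ne_zero_iff.2 hv
      have h := hmS (‖v‖⁻¹ • v) (by simp [norm_smul, hn])
      simp only [map_smul, smul_apply, smul_eq_mul] at h
      have h2 := mul_le_mul_of_nonneg_right h (sq_nonneg ‖v‖)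
      refine h2.trans_eq ?_
      field_simp

theorem eq_zero_of_mem_frontier_of_eventually_mem_iff {K : Set 𝔼} {g : 𝔼 → ℝ}
    {z : 𝔼} (hK : IsClosed K) (hg : ContinuousAt g z) (hev : ∀ᶠ y in 𝓝 z, y ∈ K ↔ g y ≤ 0)
    (hz : z ∈ frontier K) : g z = 0 := by
  have h1 : g z ≤ 0 := hev.self_of_nhds.1 (hK.frontier_subset hz)
  refine le_antisymm h1 (not_lt.1 fun hlt => hz.2 ?_)
  rw [mem_interior_iff_mem_nhds]
  filter_upwards [hg.eventually_lt continuousAt_const hlt, hev] with y hy1 hy2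
  exact hy2.2 hy1.le

/-- The gradient of a defining function is a positive multiple of every outer unit normal. -/
theorem IsOuterUnitNormal.norm_gradient_mul_inner {K : Set 𝔼} {g : 𝔼 → ℝ} {z u : 𝔼}
    (hu : IsOuterUnitNormal K z u) (hg : DifferentiableAt ℝ g z)
    (hev : ∀ᶠ y in 𝓝 z, y ∈ K ↔ g y ≤ 0) (hz0 : g z = 0) (hG : gradient g z ≠ 0) (v : 𝔼) :
    ‖gradient g z‖ * ⟪u, v⟫ = fderiv ℝ g z v := by
  set G := gradient g z with hGdef
  -- directions in which `g` decreases point into `K`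
  have hdir : ∀ v, ⟪G, v⟫ < 0 → ⟪u, v⟫ ≤ 0 := by
    intro v hv
    have hl : HasDerivAt (fun t : ℝ => z + t • v) v 0 := by
      simpa using ((hasDerivAt_id (0 : ℝ)).smul_const v).const_add z
    have hd : HasDerivAt (fun t : ℝ => g (z + t • v)) (fderiv ℝ g z v) 0 := by
      have : HasFDerivAt g (fderiv ℝ g z) (z + (0 : ℝ) • v) := by simpa using hg.hasFDerivAt
      exact this.comp_hasDerivAt 0 hl
    rw [hGdef, inner_gradient_left] at hv
    have h1 := (hasDerivAt_iff_tendsto_slope.1 hd).eventually_lt_const hv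
    have h2 : ∀ᶠ t in 𝓝[>] (0 : ℝ), slope (fun t : ℝ => g (z + t • v)) 0 t < 0 :=
      h1.filter_mono (nhdsWithin_mono _ fun t ht => ne_of_gt ht)
    have h3 : ∀ᶠ t in 𝓝[>] (0 : ℝ), z + t • v ∈ K ↔ g (z + t • v) ≤ 0 := by
      have hc : Filter.Tendsto (fun t : ℝ => z + t • v) (𝓝[>] 0) (𝓝 z) := by
        have := hl.continuousAt.tendsto
        simp only [zero_smul, add_zero] at this
        exact this.mono_left nhdsWithin_le_nhds
      exact hc.eventually hev
    obtain ⟨t, ht1, ht2, ht3⟩ := (h2.and (h3.and self_mem_nhdsWithin)).exists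
    have ht3 : 0 < t := ht3
    have hneg : g (z + t • v) ≤ 0 := by
      rw [slope_def_field] at ht1
      simp only [zero_smul, add_zero, hz0, sub_zero] at ht1
      by_contra! hp
      have := div_pos hp ht3
      linarith
    have := hu.2 _ (ht2.2 hneg)
    rw [inner_add_right, inner_smul_right] at this
    by_contra! hp
    nlinarith
  have hGn : 0 < ‖G‖ := norm_pos_iff.2 hG
  -- applied to `u - G / ‖G‖` this is the equality case of the Cauchy–Schwarz inequality
  have hkey : ‖G‖ ≤ ⟪u, G⟫ := by
    by_contra! hlt
    have h := hdir (u - ‖G‖⁻¹ • G) (by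
      rw [inner_sub_right, inner_smul_right, real_inner_self_eq_norm_sq, real_inner_comm]
      field_simp
      linarith)
    rw [inner_sub_right, inner_smul_right, real_inner_self_eq_norm_sq, hu.1] at h
    have h2 : ‖G‖⁻¹ * ⟪u, G⟫ < 1 := by rwa [inv_mul_lt_iff₀ hGn, mul_one]
    linarith
  have hzero : ‖G - ‖G‖ • u‖ ^ 2 ≤ 0 := by
    rw [norm_sub_sq_real, norm_smul, inner_smul_right, hu.1, norm_norm, real_inner_comm]
    nlinarith
  have heq : G = ‖G‖ • u := by
    rw [← sub_eq_zero, ← norm_eq_zero]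
    exact pow_eq_zero_iff (two_ne_zero) |>.1 (le_antisymm hzero (sq_nonneg _))
  rw [← inner_gradient_left, ← hGdef]
  nth_rw 2 [heq]
  rw [real_inner_smul_left]

/-- Locally, the distance of a point of `K` to a nearby supporting hyperplane is quadratic in the
distance to the point of contact, with an upper bound restricted to boundary points. -/
theorem exists_local_normal_bounds {K : Set 𝔼} (hc : Convex ℝ K) (hK : IsClosed K)
    {f : 𝔼 → ℝ} {x : 𝔼}
    (hf : IsDefiningFunctionAt K f x) (hx : x ∈ frontier K) (hG : 0 < gaussianCurvature f x) :
    ∃ ε > 0, ∃ a > 0, ∃ b > 0, ∀ z ∈ frontier K ∩ Metric.ball x ε, ∀ u,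
      IsOuterUnitNormal K z u →
        (∀ y ∈ K ∩ Metric.ball x ε, a * ‖y - z‖ ^ 2 ≤ ⟪u, z - y⟫) ∧
        (∀ y ∈ frontier K ∩ Metric.ball x ε, ⟪u, z - y⟫ ≤ b * ‖y - z‖ ^ 2) := by
  have hx0 := eq_zero_of_mem_frontier_of_eventually_mem_iff hK hf.contDiffAt.continuousAt
    hf.eventually_mem_iff hx
  obtain ⟨g, hg, m, hm, hmv⟩ := exists_isDefiningFunctionAt_hessian_pos hc hf hx hx0 hG
  set G := ‖gradient g x‖ with hGdef
  have hGpos : 0 < G := norm_pos_iff.2 hg.gradient_ne_zero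
  have hcG : ContinuousAt (fun y => ‖gradient g y‖) x :=
    (fderiv_gradient_inner hg.contDiffAt).1.continuousAt.norm
  have hev := hg.contDiffAt.eventually_norm_fderiv_fderiv_sub_lt (half_pos hm)
  obtain ⟨ε, hε, hball⟩ := Metric.eventually_nhds_iff_ball.1
    (hev.and ((hg.contDiffAt.eventually (by simp)).and
      (hg.eventually_mem_iff.and ((hcG.eventually_lt continuousAt_const
        (show ‖gradient g x‖ < 2 * G by linarith)).and
        (continuousAt_const.eventually_lt hcG (show G / 2 < ‖gradient g x‖ by linarith))))))
  set M := ‖fderiv ℝ (fderiv ℝ g) x‖ + m / 2 with hM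
  have hMpos : 0 < M := by positivity
  have hlow : ∀ w ∈ Metric.ball x ε, ∀ v,
      m / 2 * ‖v‖ ^ 2 ≤ fderiv ℝ (fderiv ℝ g) w v v ∧
      fderiv ℝ (fderiv ℝ g) w v v ≤ M * ‖v‖ ^ 2 := by
    intro w hw v
    have h1 := (fderiv ℝ (fderiv ℝ g) w - fderiv ℝ (fderiv ℝ g) x).le_opNorm₂ v v
    have h2 := (fderiv ℝ (fderiv ℝ g) x).le_opNorm₂ v v
    have h3 := (hball w hw).1
    have h4 := hmv v
    rw [Real.norm_eq_abs] at h1 h2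
    simp only [sub_apply] at h1
    have h5 := abs_le.1 h1
    have h6 := abs_le.1 h2
    have h7 := mul_le_mul_of_nonneg_right h3.le (sq_nonneg ‖v‖)
    constructor <;> nlinarith
  have hevz : ∀ z ∈ Metric.ball x ε, ∀ᶠ y in 𝓝 z, y ∈ K ↔ g y ≤ 0 := fun z hz =>
    Filter.eventually_of_mem (Metric.isOpen_ball.mem_nhds hz) fun y hy => (hball y hy).2.2.1
  have hg0 : ∀ z ∈ frontier K ∩ Metric.ball x ε, g z = 0 := fun z hz =>
    eq_zero_of_mem_frontier_of_eventually_mem_iff hK (hball z hz.2).2.1.continuousAt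
      (hevz z hz.2) hz.1
  refine ⟨ε, hε, m / (8 * G), by positivity, M / G, by positivity, fun z hz u hu => ?_⟩
  obtain ⟨-, hzd, hzK, hz2, hz1⟩ := hball z hz.2
  have hGz : gradient g z ≠ 0 := norm_pos_iff.1 (by linarith)
  have hn := hu.norm_gradient_mul_inner (hzd.differentiableAt (by norm_num)) (hevz z hz.2)
    (hg0 z hz) hGz
  constructor
  · intro y hy
    have hT := taylor_lower_bound_segment (g := g) (z := z) (y := y) (m := m / 2 * ‖y - z‖ ^ 2)
      (fun w hw => (hball w (mem_of_mem_segment_ball hz.2 hy.2 hw)).2.1)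
      (fun w hw => (hlow w (mem_of_mem_segment_ball hz.2 hy.2 hw) _).1)
    rw [hg0 z hz, ← hn, ← neg_sub z y, inner_neg_right, norm_neg] at hT
    rw [← norm_sub_rev z y]
    have hy0 := (hball y hy.2).2.2.1.1 hy.1
    have hip : 0 ≤ ⟪u, z - y⟫ := by
      have := hu.2 y hy.1
      rw [inner_sub_right]; linarith
    rw [div_mul_eq_mul_div, div_le_iff₀ (by positivity)]
    nlinarith
  · intro y hy
    have hT := taylor_upper_bound_segment (g := g) (z := z) (y := y) (m := M * ‖y - z‖ ^ 2)
      (fun w hw => (hball w (mem_of_mem_segment_ball hz.2 hy.2 hw)).2.1)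
      (fun w hw => (hlow w (mem_of_mem_segment_ball hz.2 hy.2 hw) _).2)
    rw [hg0 z hz, hg0 y hy, ← hn, ← neg_sub z y, inner_neg_right, norm_neg] at hT
    rw [← norm_sub_rev z y]
    have hip : 0 ≤ ⟪u, z - y⟫ := by
      have := hu.2 y (hK.frontier_subset hy.1)
      rw [inner_sub_right]; linarith
    rw [div_mul_eq_mul_div, le_div_iff₀ (by positivity)]
    nlinarith

end Curvature

/-! ### Uniform contact of supporting hyperplanes -/

section Global

variable {d : ℕ}

local notation "𝔼" => EuclideanSpace ℝ (Fin d)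

theorem exists_forall_norm_sub_le (K : ConvexBody 𝔼) :
    ∃ D > 0, ∀ y ∈ (K : Set 𝔼), ∀ z ∈ (K : Set 𝔼), ‖y - z‖ ≤ D := by
  refine ⟨Metric.diam (K : Set 𝔼) + 1, by positivity, fun y hy z hz => ?_⟩
  rw [← dist_eq_norm]
  linarith [Metric.dist_le_diam_of_mem K.isBounded hy hz]

theorem exists_local_uniform_normal_bounds (K : ConvexBody 𝔼) (hK : IsC2Plus K) :
    ∃ ε > 0, ∃ a > 0, ∃ b > 0, ∀ z ∈ frontier (K : Set 𝔼), ∀ u,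
      IsOuterUnitNormal (K : Set 𝔼) z u →
        (∀ y ∈ (K : Set 𝔼), ‖y - z‖ < ε → a * ‖y - z‖ ^ 2 ≤ ⟪u, z - y⟫) ∧
        (∀ y ∈ frontier (K : Set 𝔼), ‖y - z‖ < ε → ⟪u, z - y⟫ ≤ b * ‖y - z‖ ^ 2) := by
  have hcpt : IsCompact (frontier (K : Set 𝔼)) :=
    K.isCompact.of_isClosed_subset isClosed_frontier K.isClosed.frontier_subset
  suffices h : ∃ ε > 0, ∃ a > 0, ∃ b > 0,
      ∀ z ∈ frontier (K : Set 𝔼) ∩ frontier (K : Set 𝔼), ∀ u,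
      IsOuterUnitNormal (K : Set 𝔼) z u →
        (∀ y ∈ (K : Set 𝔼), ‖y - z‖ < ε → a * ‖y - z‖ ^ 2 ≤ ⟪u, z - y⟫) ∧
        (∀ y ∈ frontier (K : Set 𝔼), ‖y - z‖ < ε → ⟪u, z - y⟫ ≤ b * ‖y - z‖ ^ 2) by
    simpa using h
  refine hcpt.induction_on (p := fun s => ∃ ε > 0, ∃ a > 0, ∃ b > 0,
      ∀ z ∈ s ∩ frontier (K : Set 𝔼), ∀ u,
      IsOuterUnitNormal (K : Set 𝔼) z u →
        (∀ y ∈ (K : Set 𝔼), ‖y - z‖ < ε → a * ‖y - z‖ ^ 2 ≤ ⟪u, z - y⟫) ∧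
        (∀ y ∈ frontier (K : Set 𝔼), ‖y - z‖ < ε → ⟪u, z - y⟫ ≤ b * ‖y - z‖ ^ 2)) ?_ ?_ ?_ ?_
  · exact ⟨1, one_pos, 1, one_pos, 1, one_pos, by simp⟩
  · rintro s t hst ⟨ε, hε, a, ha, b, hb, h⟩
    exact ⟨ε, hε, a, ha, b, hb, fun z hz => h z ⟨hst hz.1, hz.2⟩⟩
  · rintro s t ⟨ε, hε, a, ha, b, hb, h⟩ ⟨ε', hε', a', ha', b', hb', h'⟩
    refine ⟨min ε ε', lt_min hε hε', min a a', lt_min ha ha', max b b', lt_max_of_lt_left hb,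
      fun z hz u hu => ?_⟩
    rcases hz with ⟨hz | hz, hzf⟩
    · obtain ⟨h1, h2⟩ := h z ⟨hz, hzf⟩ u hu
      refine ⟨fun y hy hyz => le_trans ?_ (h1 y hy (hyz.trans_le (min_le_left _ _))),
        fun y hy hyz => (h2 y hy (hyz.trans_le (min_le_left _ _))).trans ?_⟩
      · gcongr; exact min_le_left _ _
      · gcongr; exact le_max_left _ _
    · obtain ⟨h1, h2⟩ := h' z ⟨hz, hzf⟩ u hu
      refine ⟨fun y hy hyz => le_trans ?_ (h1 y hy (hyz.trans_le (min_le_right _ _))),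
        fun y hy hyz => (h2 y hy (hyz.trans_le (min_le_right _ _))).trans ?_⟩
      · gcongr; exact min_le_right _ _
      · gcongr; exact le_max_right _ _
  · intro x hx
    obtain ⟨f, hf, hG⟩ := hK.2 x hx
    obtain ⟨ε, hε, a, ha, b, hb, h⟩ := exists_local_normal_bounds K.convex K.isClosed hf hx hG
    refine ⟨Metric.ball x (ε / 2), mem_nhdsWithin_of_mem_nhds (Metric.ball_mem_nhds _ (half_pos hε)),
      ε / 2, half_pos hε, a, ha, b, hb, fun z hz u hu => ?_⟩
    have hzx : dist z x < ε / 2 := hz.1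
    obtain ⟨h1, h2⟩ := h z ⟨hz.2, by rw [Metric.mem_ball]; linarith⟩ u hu
    have hnear : ∀ y, ‖y - z‖ < ε / 2 → y ∈ Metric.ball x ε := by
      intro y hy
      rw [← dist_eq_norm] at hy
      rw [Metric.mem_ball]
      linarith [dist_triangle y z x]
    exact ⟨fun y hy hyz => h1 y ⟨hy, hnear y hyz⟩, fun y hy hyz => h2 y ⟨hy, hnear y hyz⟩⟩

/-- Quantitative form of the class `C²₊`: every supporting hyperplane is touched from inside and
from outside to exactly second order, with constants that do not depend on the point of contact.
Points far from the point of contact are reduced to near ones by convexity. -/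
theorem exists_normal_bounds (K : ConvexBody 𝔼) (hK : IsC2Plus K) :
    ∃ a > 0, ∃ b > 0, ∀ z ∈ frontier (K : Set 𝔼), ∀ u, IsOuterUnitNormal (K : Set 𝔼) z u →
        (∀ y ∈ (K : Set 𝔼), a * ‖y - z‖ ^ 2 ≤ ⟪u, z - y⟫) ∧
        (∀ y ∈ frontier (K : Set 𝔼), ⟪u, z - y⟫ ≤ b * ‖y - z‖ ^ 2) := by
  obtain ⟨ε, hε, a, ha, b, hb, h⟩ := exists_local_uniform_normal_bounds K hK
  obtain ⟨D, hD, hdist⟩ := exists_forall_norm_sub_le K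
  refine ⟨min a (a * ε / (2 * D)), by positivity, max b (1 / ε), by positivity,
    fun z hz u hu => ?_⟩
  obtain ⟨h1, h2⟩ := h z hz u hu
  have hzK := K.isClosed.frontier_subset hz
  constructor
  · intro y hy
    rcases lt_or_ge ‖y - z‖ ε with hlt | hge
    · refine le_trans ?_ (h1 y hy hlt)
      gcongr
      exact min_le_left _ _
    · have hpos : 0 < ‖y - z‖ := hε.trans_le hge
      set t := ε / 2 / ‖y - z‖ with ht
      have ht0 : 0 < t := by positivity
      have ht1 : t ≤ 1 := by
        rw [ht, div_le_one hpos]; linarith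
      have hsub : z + t • (y - z) - z = t • (y - z) := by simp
      have hnorm : ‖z + t • (y - z) - z‖ = ε / 2 := by
        rw [hsub, norm_smul, Real.norm_eq_abs, abs_of_pos ht0, ht]
        field_simp
      have h3 := h1 (z + t • (y - z)) (K.convex.add_smul_sub_mem hzK hy ⟨ht0.le, ht1⟩)
        (by rw [hnorm]; linarith)
      rw [hnorm, show z - (z + t • (y - z)) = t • (z - y) by module, inner_smul_right] at h3
      have h4 : a * ε / 2 * ‖y - z‖ ≤ ⟪u, z - y⟫ := by
        rw [ht, div_mul_eq_mul_div, le_div_iff₀ hpos] at h3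
        nlinarith
      refine le_trans ?_ h4
      calc min a (a * ε / (2 * D)) * ‖y - z‖ ^ 2 ≤ a * ε / (2 * D) * (D * ‖y - z‖) := by
            rw [sq]
            gcongr
            · exact min_le_right _ _
            · exact hdist y hy z hzK
        _ = a * ε / 2 * ‖y - z‖ := by field_simp
  · intro y hy
    rcases lt_or_ge ‖y - z‖ ε with hlt | hge
    · refine (h2 y hy hlt).trans ?_
      gcongr
      exact le_max_left _ _
    · have hcs : ⟪u, z - y⟫ ≤ ‖y - z‖ := by
        have := real_inner_le_norm u (z - y)
        rwa [hu.1, one_mul, norm_sub_rev] at this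
      refine hcs.trans ?_
      calc ‖y - z‖ = 1 / ε * (ε * ‖y - z‖) := by field_simp
        _ ≤ max b (1 / ε) * ‖y - z‖ ^ 2 := by
            rw [sq]
            gcongr
            exact le_max_right _ _

/-- A cap cut off by a half-space with `x` on its boundary contains, around its point `z` of largest
height `h`, all boundary points within distance of order `√h`, whereas its diameter is at most of
order `√h`. The scale `s` is `√(h / a)`; its bound `1 / q` keeps the radius `q * s` in the range
where boundary balls have measure of the expected order. -/
theorem exists_ball_inter_frontier_subset_cap (K : ConvexBody 𝔼) (hK : IsC2Plus K) :
    ∃ q > 0, ∀ x ∈ (K : Set 𝔼), ∀ y ∈ (K : Set 𝔼), y ≠ x → ∀ u : 𝔼, u ≠ 0 → ⟪u, x⟫ ≤ ⟪u, y⟫ →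
      ∃ z ∈ frontier (K : Set 𝔼), ∃ s : ℝ, ‖y - x‖ ≤ 2 * s ∧ ‖z - x‖ ≤ s ∧
        s ≤ 1 / q ∧
        ∀ w ∈ frontier (K : Set 𝔼), ‖w - z‖ < q * s → ⟪u, x⟫ < ⟪u, w⟫ := by
  obtain ⟨a, ha, b, hb, hab⟩ := exists_normal_bounds K hK
  obtain ⟨D, hD, hdist⟩ := exists_forall_norm_sub_le K
  refine ⟨min (√(a / b)) (1 / √(D / a)), by positivity, fun x hx y hy hyx u hu hxy => ?_⟩
  obtain ⟨z, hz, hmax⟩ := K.isCompact.exists_isMaxOn K.nonempty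
    (f := fun w => ⟪‖u‖⁻¹ • u, w⟫) (by fun_prop)
  set e := ‖u‖⁻¹ • u with he
  have hupos : 0 < ‖u‖ := norm_pos_iff.2 hu
  have hin : ∀ w, ⟪u, w⟫ = ‖u‖ * ⟪e, w⟫ := fun w => by
    rw [he, real_inner_smul_left, mul_inv_cancel_left₀ hupos.ne']
  have hne : IsOuterUnitNormal (K : Set 𝔼) z e :=
    ⟨by rw [he, norm_smul, norm_inv, norm_norm, inv_mul_cancel₀ hupos.ne'], fun w hw => hmax hw⟩
  have hzf : z ∈ frontier (K : Set 𝔼) := ⟨subset_closure hz, hne.notMem_interior⟩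
  have hxy' : ⟪e, x⟫ ≤ ⟪e, y⟫ := by
    rw [hin, hin] at hxy
    exact le_of_mul_le_mul_left hxy hupos
  obtain ⟨hlow, hup⟩ := hab z hzf e hne
  set h := ⟪e, z - x⟫ with hh
  have hhx := hlow x hx
  have hhy : a * ‖y - z‖ ^ 2 ≤ h := (hlow y hy).trans (by
    rw [hh, inner_sub_right, inner_sub_right]; linarith)
  have hh0 : 0 ≤ h := le_trans (by positivity) hhy
  have hs : ∀ v : 𝔼, a * ‖v‖ ^ 2 ≤ h → ‖v‖ ≤ √(h / a) := by
    intro v hv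
    apply Real.le_sqrt_of_sq_le
    rw [le_div_iff₀ ha]
    linarith
  have hzx : ‖z - x‖ ≤ √(h / a) := by
    rw [norm_sub_rev]; exact hs _ hhx
  have hyz := hs _ hhy
  have hyx2 : ‖y - x‖ ≤ 2 * √(h / a) := by
    have := norm_sub_le_norm_sub_add_norm_sub y z x
    linarith
  refine ⟨z, hzf, √(h / a), hyx2, hzx, ?_, fun w hw hwz => ?_⟩
  · have hle : √(h / a) ≤ √(D / a) := by
      gcongr
      have := real_inner_le_norm e (z - x)
      rw [hne.1, one_mul] at this
      exact this.trans (hdist z hz x hx)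
    refine hle.trans ?_
    rw [le_div_iff₀ (by positivity)]
    calc √(D / a) * min (√(a / b)) (1 / √(D / a)) ≤ √(D / a) * (1 / √(D / a)) := by
          gcongr; exact min_le_right _ _
      _ = 1 := by field_simp
  · have h1 := hup w hw
    have h2 : ‖w - z‖ < √(h / b) := by
      refine hwz.trans_le ?_
      calc min (√(a / b)) (1 / √(D / a)) * √(h / a) ≤ √(a / b) * √(h / a) := by
            gcongr; exact min_le_left _ _
        _ = √(h / b) := by
            rw [← Real.sqrt_mul (by positivity)]
            congr 1
            field_simp
    have h3 : ‖w - z‖ ^ 2 < h / b := (Real.lt_sqrt (norm_nonneg _)).1 h2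
    rw [lt_div_iff₀ hb] at h3
    have h4 : ⟪e, z - w⟫ < ⟪e, z - x⟫ := by
      rw [← hh]; linarith
    rw [inner_sub_right, inner_sub_right] at h4
    rw [hin, hin]
    exact mul_lt_mul_of_pos_left (by linarith) hupos

end Global

/-! ### Hausdorff measure of the boundary of a convex body -/

section HausdorffMeasure

variable {m : ℕ}

local notation "𝔼" => EuclideanSpace ℝ (Fin (m + 1))

theorem IsPreconnected.exists_mem_frontier {X : Type*} [TopologicalSpace X] {s K : Set X}
    (hs : IsPreconnected s) (h1 : (s ∩ K).Nonempty) (h2 : (s ∩ Kᶜ).Nonempty) :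
    ∃ x ∈ s, x ∈ frontier K := by
  by_contra! hno
  have hcov : s ⊆ interior K ∪ interior Kᶜ := fun x hx => by
    rw [← compl_frontier_eq_union_interior]
    exact hno x hx
  obtain ⟨x, hxs, hx⟩ := h1
  obtain ⟨y, hys, hy⟩ := h2
  obtain ⟨w, -, hw1, hw2⟩ := hs _ _ isOpen_interior isOpen_interior hcov
    ⟨x, hxs, (hcov hxs).resolve_right fun h => interior_subset h hx⟩
    ⟨y, hys, (hcov hys).resolve_left fun h => hy (interior_subset h)⟩
  exact interior_subset hw2 (interior_subset hw1)

theorem IsOuterUnitNormal.exists_add_smul_mem_frontier {K : Set 𝔼} {p z u : 𝔼} (hp : p ∈ K)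
    (hu : IsOuterUnitNormal K z u) : ∃ t : ℝ, 0 ≤ t ∧ p + t • u ∈ frontier K := by
  have hcs : -‖p - z‖ ≤ ⟪u, p - z⟫ := by
    have := (abs_le.1 (abs_real_inner_le_norm u (p - z))).1
    rwa [hu.1, one_mul] at this
  have hpre : IsPreconnected ((fun t : ℝ => p + t • u) '' Set.Ici 0) :=
    isPreconnected_Ici.image _ (by fun_prop)
  obtain ⟨_, ⟨t, ht, rfl⟩, hf⟩ := hpre.exists_mem_frontier (K := K)
    ⟨p, ⟨0, Set.self_mem_Ici, by simp⟩, hp⟩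
    ⟨p + (‖p - z‖ + 1) • u, ⟨_, by simp; positivity, rfl⟩, fun hK => by
      have := hu.2 _ hK
      rw [inner_add_right, inner_smul_right, real_inner_self_eq_norm_sq, hu.1] at this
      rw [inner_sub_right] at hcs
      linarith⟩
  exact ⟨t, ht, hf⟩

/-- The boundary of a convex body within distance `δ` of a boundary point `z` has measure at least
of order `δ ^ m`: along the normal direction at `z` it projects onto a set that contains the
projection of a ball of radius comparable to `δ` in `K`. -/
theorem exists_le_hausdorffMeasure_frontier_inter_ball (K : ConvexBody 𝔼)
    (hK : (interior (K : Set 𝔼)).Nonempty) {M : ℝ} (hM : 0 < M) :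
    ∃ κ > 0, ∀ z ∈ frontier (K : Set 𝔼), ∀ δ : ℝ, 0 < δ → δ ≤ M →
      ENNReal.ofReal (κ * δ ^ m) ≤
        Measure.hausdorffMeasure (m : ℝ) (frontier (K : Set 𝔼) ∩ Metric.ball z δ) := by
  obtain ⟨o, ho⟩ := hK
  obtain ⟨r, hr, hball⟩ := Metric.mem_nhds_iff.1 (mem_interior_iff_mem_nhds.1 ho)
  obtain ⟨D, hD, hdist⟩ := exists_forall_norm_sub_le K
  set Λ := M + 4 * D with hΛ
  have hΛpos : 0 < Λ := by positivity
  refine ⟨(2 * (r / Λ / (m + 1))) ^ m, by positivity, fun z hz δ hδ hδM => ?_⟩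
  obtain ⟨u, hu⟩ := exists_isOuterUnitNormal K.convex ⟨o, ho⟩ hz
  have hzK := K.isClosed.frontier_subset hz
  set l := δ / Λ with hl
  have hl0 : 0 < l := by positivity
  have hl1 : l ≤ 1 := by
    rw [hl, div_le_one hΛpos]; linarith
  have hlD : l * D ≤ δ / 4 := by
    rw [hl, div_mul_eq_mul_div, div_le_iff₀ hΛpos, hΛ]
    nlinarith
  set p := z + l • (o - z) with hp
  -- points of `K` near `z`, filling a ball of radius `l * r`, and their exits along the normal
  have hexit : ∀ v : 𝔼, ‖v‖ < l * r → ∃ t : ℝ,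
      p + v + t • u ∈ frontier (K : Set 𝔼) ∩ Metric.ball z δ := by
    intro v hv
    have ho' : o + l⁻¹ • v ∈ (K : Set 𝔼) := hball (by
      rw [Metric.mem_ball, dist_eq_norm, add_sub_cancel_left, norm_smul, norm_inv,
        Real.norm_eq_abs, abs_of_pos hl0, inv_mul_lt_iff₀ hl0]
      exact hv)
    have hpv : p + v = z + l • (o + l⁻¹ • v - z) := by
      rw [hp, smul_sub, smul_sub, smul_add, smul_inv_smul₀ hl0.ne']
      abel
    have hpK : p + v ∈ (K : Set 𝔼) := by
      rw [hpv]
      exact K.convex.add_smul_sub_mem hzK ho' ⟨hl0.le, hl1⟩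
    have hpz : ‖p + v - z‖ ≤ δ / 4 := by
      rw [hpv, add_sub_cancel_left, norm_smul, Real.norm_eq_abs, abs_of_pos hl0]
      exact (mul_le_mul_of_nonneg_left (hdist _ ho' _ hzK) hl0.le).trans hlD
    obtain ⟨t, ht0, htf⟩ := hu.exists_add_smul_mem_frontier hpK
    refine ⟨t, htf, ?_⟩
    have ht : t ≤ δ / 4 := by
      have h1 := hu.2 _ (K.isClosed.frontier_subset htf)
      have h2 := (abs_le.1 (abs_real_inner_le_norm u (p + v - z))).1
      rw [hu.1, one_mul, inner_sub_right] at h2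
      rw [inner_add_right u, inner_smul_right, real_inner_self_eq_norm_sq, hu.1] at h1
      linarith
    rw [Metric.mem_ball, dist_eq_norm, add_sub_right_comm]
    refine (norm_add_le _ _).trans_lt ?_
    rw [norm_smul, hu.1, Real.norm_eq_abs, abs_of_nonneg ht0]
    linarith
  have : Fact (Module.finrank ℝ 𝔼 = m + 1) := ⟨by simp⟩
  have hu0 : u ≠ 0 := norm_ne_zero_iff.1 (by rw [hu.1]; exact one_ne_zero)
  let b := OrthonormalBasis.fromOrthogonalSpanSingleton (𝕜 := ℝ) m hu0
  have hbn : ∀ i, ‖(b i : 𝔼)‖ = 1 := fun i => b.orthonormal.1 i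
  have hbu : ∀ i, ⟪(b i : 𝔼), u⟫ = 0 := fun i => by
    rw [real_inner_comm]
    exact (Submodule.mem_orthogonal_singleton_iff_inner_right).1 (b i).2
  have hbb : ∀ i j, ⟪(b i : 𝔼), (b j : 𝔼)⟫ = if i = j then 1 else 0 := fun i j =>
    orthonormal_iff_ite.1 b.orthonormal i j
  let π : 𝔼 → (Fin m → ℝ) := fun v i => ⟪(b i : 𝔼), v⟫
  have hπ : LipschitzWith 1 π := by
    refine LipschitzWith.of_dist_le_mul fun v w => ?_
    rw [NNReal.coe_one, one_mul, dist_pi_le_iff dist_nonneg]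
    intro i
    rw [Real.dist_eq, dist_eq_norm, ← inner_sub_right]
    refine (abs_real_inner_le_norm _ _).trans ?_
    rw [hbn, one_mul]
  set η := l * r / (m + 1) with hη
  have hη0 : 0 < η := by positivity
  have hsub : Metric.ball (π p) η ⊆ π '' (frontier (K : Set 𝔼) ∩ Metric.ball z δ) := by
    intro c hc
    rw [Metric.mem_ball, dist_pi_lt_iff hη0] at hc
    obtain ⟨t, ht⟩ := hexit (∑ i, (c i - π p i) • (b i : 𝔼)) (by
      calc ‖∑ i, (c i - π p i) • (b i : 𝔼)‖ ≤ ∑ i : Fin m, η := by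
            refine (norm_sum_le _ _).trans (Finset.sum_le_sum fun i _ => ?_)
            rw [norm_smul, hbn, mul_one]
            exact (hc i).le
        _ = m * η := by simp
        _ < (m + 1) * η := by linarith
        _ = l * r := by rw [hη]; field_simp)
    refine ⟨_, ht, ?_⟩
    ext j
    simp only [π, inner_add_right, inner_smul_right, hbu, inner_sum, hbb]
    simp
  calc ENNReal.ofReal ((2 * (r / Λ / (m + 1))) ^ m * δ ^ m)
      = ENNReal.ofReal ((2 * η) ^ m) := by
        rw [← mul_pow, hη, hl]
        congr 2
        field_simp
    _ = volume (Metric.ball (π p) η) := by rw [Real.volume_pi_ball _ hη0, Fintype.card_fin]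
    _ = Measure.hausdorffMeasure (m : ℝ) (Metric.ball (π p) η) := by
        rw [← hausdorffMeasure_pi_real, Fintype.card_fin]
    _ ≤ Measure.hausdorffMeasure (m : ℝ) (π '' (frontier (K : Set 𝔼) ∩ Metric.ball z δ)) :=
        measure_mono hsub
    _ ≤ Measure.hausdorffMeasure (m : ℝ) (frontier (K : Set 𝔼) ∩ Metric.ball z δ) := by
        simpa using hπ.hausdorffMeasure_image_le (d := m) (by positivity)
          (frontier (K : Set 𝔼) ∩ Metric.ball z δ)

theorem norm_le_sum_abs (v : 𝔼) : ‖v‖ ≤ ∑ i, |v i| := by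
  conv_lhs => rw [← (EuclideanSpace.basisFun (Fin (m + 1)) ℝ).sum_repr v]
  refine (norm_sum_le _ _).trans (Finset.sum_le_sum fun i _ => ?_)
  rw [norm_smul]
  simp

/-- The points of a bounded set that have an outer unit normal whose `i`-th coordinate is bounded
away from zero, with fixed sign `σ`, form a Lipschitz graph over the remaining coordinates. -/
theorem hausdorffMeasure_normal_coordinate_lt_top {K : Set 𝔼} (hK : Bornology.IsBounded K)
    (i : Fin (m + 1)) {σ : ℝ} (hσ : σ * σ = 1) :
    Measure.hausdorffMeasure (m : ℝ)
      {x | x ∈ K ∧ ∃ u, IsOuterUnitNormal K x u ∧ 1 / ((m : ℝ) + 1) ≤ σ * u i} < ⊤ := by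
  set S := {x | x ∈ K ∧ ∃ u, IsOuterUnitNormal K x u ∧ 1 / ((m : ℝ) + 1) ≤ σ * u i} with hS
  let π : 𝔼 → (Fin m → ℝ) := fun v j => v (i.succAbove j)
  have hcoord : ∀ (v : 𝔼) j, |v j| ≤ ‖v‖ := fun v j => PiLp.norm_apply_le v j
  have hone : ∀ x ∈ S, ∀ y ∈ S, σ * (y i - x i) ≤ (m + 1) * (m * dist (π x) (π y)) := by
    rintro x ⟨hx, u, hu, hui⟩ y ⟨hy, -⟩
    have hin := hu.2 y hy
    have hexp : ⟪u, y - x⟫ = u i * (y i - x i) +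
        ∑ j : Fin m, u (i.succAbove j) * (y (i.succAbove j) - x (i.succAbove j)) := by
      rw [PiLp.inner_apply, Fin.sum_univ_succAbove _ i]
      simp [mul_comm]
    have hsum : -(m * dist (π x) (π y)) ≤
        ∑ j : Fin m, u (i.succAbove j) * (y (i.succAbove j) - x (i.succAbove j)) := by
      have : ∑ j : Fin m, -dist (π x) (π y) ≤
          ∑ j : Fin m, u (i.succAbove j) * (y (i.succAbove j) - x (i.succAbove j)) := by
        refine Finset.sum_le_sum fun j _ => ?_
        refine neg_le_of_abs_le ?_
        rw [abs_mul]
        calc |u (i.succAbove j)| * |y (i.succAbove j) - x (i.succAbove j)|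
            ≤ 1 * dist (π x) (π y) := by
              gcongr
              · exact (hcoord u _).trans hu.1.le
              · rw [← Real.dist_eq, dist_comm]
                exact dist_le_pi_dist (π x) (π y) j
          _ = dist (π x) (π y) := one_mul _
      simpa using this
    rw [inner_sub_right] at hexp
    have hprod : u i * (y i - x i) = (σ * u i) * (σ * (y i - x i)) := by
      linear_combination (-(u i * (y i - x i))) * hσ
    have hle : (σ * u i) * (σ * (y i - x i)) ≤ m * dist (π x) (π y) := by
      rw [← hprod]; linarith
    rcases le_total (σ * (y i - x i)) 0 with h | h
    · exact h.trans (by positivity)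
    · have h2 := (mul_le_mul_of_nonneg_right hui h).trans hle
      rw [div_mul_eq_mul_div, one_mul, div_le_iff₀ (by positivity)] at h2
      linarith
  have hanti : AntilipschitzWith (m * (m + 2)) (fun x : S => π x) := by
    refine AntilipschitzWith.of_le_mul_dist fun x y => ?_
    have h1 := hone x x.2 y y.2
    have h2 := hone y y.2 x x.2
    rw [dist_comm (π y) (π x)] at h2
    have habs : |(x : 𝔼) i - (y : 𝔼) i| ≤ (m + 1) * (m * dist (π x) (π y)) := by
      have hs1 : |σ| = 1 := by
        rw [← abs_mul_abs_self σ] at hσ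
        nlinarith [abs_nonneg σ]
      have : |σ * ((x : 𝔼) i - (y : 𝔼) i)| ≤ (m + 1) * (m * dist (π x) (π y)) :=
        abs_le.2 ⟨by linarith, h2⟩
      rwa [abs_mul, hs1, one_mul] at this
    have hsum : ∑ j : Fin m, |(x : 𝔼) (i.succAbove j) - (y : 𝔼) (i.succAbove j)| ≤
        m * dist (π x) (π y) := by
      have : ∑ j : Fin m, |(x : 𝔼) (i.succAbove j) - (y : 𝔼) (i.succAbove j)| ≤
          ∑ j : Fin m, dist (π x) (π y) := by
        refine Finset.sum_le_sum fun j _ => ?_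
        rw [← Real.dist_eq]
        exact dist_le_pi_dist (π x) (π y) j
      simpa using this
    have hn := norm_le_sum_abs ((x : 𝔼) - (y : 𝔼))
    rw [Fin.sum_univ_succAbove _ i] at hn
    simp only [PiLp.sub_apply] at hn
    rw [Subtype.dist_eq, dist_eq_norm]
    push_cast
    linarith
  have hle := hanti.le_hausdorffMeasure_image (d := m) (by positivity) Set.univ
  have hSeq : Measure.hausdorffMeasure (m : ℝ) S =
      Measure.hausdorffMeasure (m : ℝ) (Set.univ : Set S) := by
    rw [← (isometry_subtype_coe (s := S)).hausdorffMeasure_image (Or.inl (by positivity))]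
    simp
  rw [hSeq]
  refine hle.trans_lt (ENNReal.mul_lt_top
    (ENNReal.rpow_lt_top_of_nonneg (by positivity) ENNReal.coe_ne_top) ?_)
  have hbdd : Bornology.IsBounded ((fun x : S => π x) '' Set.univ) := by
    obtain ⟨R, hR⟩ := hK.exists_norm_le
    refine isBounded_iff_forall_norm_le.2 ⟨R, ?_⟩
    rintro _ ⟨x, -, rfl⟩
    have hxR := hR x x.2.1
    exact (pi_norm_le_iff_of_nonneg ((norm_nonneg _).trans hxR)).2
      fun j => (hcoord x _).trans hxR
  have hv : Measure.hausdorffMeasure (m : ℝ) = (volume : Measure (Fin m → ℝ)) := by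
    rw [← hausdorffMeasure_pi_real, Fintype.card_fin]
  rw [hv]
  exact hbdd.measure_lt_top

theorem hausdorffMeasure_frontier_lt_top (K : ConvexBody 𝔼)
    (hK : (interior (K : Set 𝔼)).Nonempty) :
    Measure.hausdorffMeasure (m : ℝ) (frontier (K : Set 𝔼)) < ⊤ := by
  have hsub : frontier (K : Set 𝔼) ⊆ ⋃ i : Fin (m + 1), ⋃ σ : ({1, -1} : Set ℝ),
      {x | x ∈ (K : Set 𝔼) ∧ ∃ u, IsOuterUnitNormal (K : Set 𝔼) x u ∧
        1 / ((m : ℝ) + 1) ≤ σ * u i} := by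
    intro x hx
    obtain ⟨u, hu⟩ := exists_isOuterUnitNormal K.convex hK hx
    have hxK := K.isClosed.frontier_subset hx
    obtain ⟨i, -, hi⟩ : ∃ i ∈ Finset.univ, 1 / ((m : ℝ) + 1) ≤ |u i| := by
      refine Finset.exists_le_of_sum_le Finset.univ_nonempty ?_
      have h := norm_le_sum_abs u
      rw [hu.1] at h
      refine le_trans (le_of_eq ?_) h
      simp
      field_simp
    simp only [Set.mem_iUnion]
    rcases abs_cases (u i) with h | h
    · exact ⟨i, ⟨1, by simp⟩, hxK, u, hu, by simpa [h.1] using hi⟩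
    · exact ⟨i, ⟨-1, by simp⟩, hxK, u, hu, by simpa [h.1] using hi⟩
  refine (measure_mono hsub).trans_lt ?_
  refine (measure_iUnion_fintype_le _ _).trans_lt (ENNReal.sum_lt_top.2 fun i _ => ?_)
  have : Fintype ({1, -1} : Set ℝ) := Fintype.ofFinite _
  refine (measure_iUnion_fintype_le _ _).trans_lt (ENNReal.sum_lt_top.2 fun σ _ => ?_)
  refine hausdorffMeasure_normal_coordinate_lt_top K.isBounded i ?_
  rcases σ.2 with h | h <;> rw [h] <;> norm_num

end HausdorffMeasure

/-! ### The uniform distribution on the boundary -/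

section BoundaryUniform

variable {m : ℕ}

local notation "𝔼" => EuclideanSpace ℝ (Fin (m + 1))

theorem exists_le_boundaryUniform_ball (K : ConvexBody 𝔼) (hK : (interior (K : Set 𝔼)).Nonempty)
    {M : ℝ} (hM : 0 < M) :
    ∃ κ > 0, ∀ z ∈ frontier (K : Set 𝔼), ∀ δ : ℝ, 0 < δ → δ ≤ M →
      ENNReal.ofReal (κ * δ ^ m) ≤
        boundaryUniform K (Metric.ball z δ ∩ frontier (K : Set 𝔼)) := by
  obtain ⟨κ, hκ, h⟩ := exists_le_hausdorffMeasure_frontier_inter_ball K hK hM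
  have hfin := hausdorffMeasure_frontier_lt_top K hK
  set V := Measure.hausdorffMeasure (m : ℝ) (frontier (K : Set 𝔼)) with hV
  refine ⟨κ / (V.toReal + 1), by positivity, fun z hz δ hδ hδM => ?_⟩
  have hdim : (((m + 1 : ℕ) : ℝ) - 1) = m := by push_cast; ring
  rw [boundaryUniform, cond_apply isClosed_frontier.measurableSet, hdim, ← hV,
    Set.inter_comm (Metric.ball z δ), ← Set.inter_assoc, Set.inter_self]
  have hV1 : ENNReal.ofReal ((V.toReal + 1)⁻¹) ≤ V⁻¹ := by
    rw [ENNReal.ofReal_inv_of_pos (by positivity), ENNReal.inv_le_inv,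
      ENNReal.le_ofReal_iff_toReal_le hfin.ne (by positivity)]
    linarith
  calc ENNReal.ofReal (κ / (V.toReal + 1) * δ ^ m)
      = ENNReal.ofReal ((V.toReal + 1)⁻¹) * ENNReal.ofReal (κ * δ ^ m) := by
        rw [← ENNReal.ofReal_mul (by positivity)]
        congr 1
        ring
    _ ≤ _ := mul_le_mul' hV1 (h z hz δ hδ hδM)

/-- The probability that `n` independent points all miss a set of measure at least `p` is at most
`(1 - p) ^ n ≤ exp (-p n)`. -/
theorem measure_forall_notMem_le_exp {E Ω : Type*} [MeasurableSpace E] [MeasurableSpace Ω]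
    {P : Measure Ω} [IsProbabilityMeasure P] {μ : Measure E} {n : ℕ} {X : Fin n → Ω → E}
    (hX : iIndepFun X P) (hlaw : ∀ i, HasLaw (X i) μ P) {A : Set E} (hA : MeasurableSet A)
    {p : ℝ} (hp : ENNReal.ofReal p ≤ μ A) :
    P {ω | ∀ i, X i ω ∉ A} ≤ ENNReal.ofReal (Real.exp (-p * n)) := by
  have heq : {ω | ∀ i, X i ω ∉ A} = ⋂ i ∈ (Finset.univ : Finset (Fin n)), X i ⁻¹' Aᶜ := by
    ext ω; simp
  have hone : ∀ i, P (X i ⁻¹' Aᶜ) ≤ ENNReal.ofReal (Real.exp (-p)) := by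
    intro i
    have := (hlaw i).aemeasurable
    have hc : P (X i ⁻¹' A)ᶜ = 1 - P (X i ⁻¹' A) :=
      prob_compl_eq_one_sub₀ (this.nullMeasurableSet_preimage hA)
    rw [Set.preimage_compl, hc, ← Measure.map_apply_of_aemeasurable this hA, (hlaw i).map_eq]
    calc 1 - μ A ≤ 1 - ENNReal.ofReal p := tsub_le_tsub_left hp _
      _ ≤ ENNReal.ofReal (1 - p) := by
          rw [tsub_le_iff_right, ← ENNReal.ofReal_one]
          exact (ENNReal.ofReal_le_ofReal (by linarith)).trans ENNReal.ofReal_add_le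
      _ ≤ _ := ENNReal.ofReal_le_ofReal (by linarith [Real.add_one_le_exp (-p)])
  rw [heq, hX.measure_inter_preimage_eq_mul _ fun i _ => hA.compl]
  calc ∏ i : Fin n, P (X i ⁻¹' Aᶜ) ≤ ∏ i : Fin n, ENNReal.ofReal (Real.exp (-p)) :=
        Finset.prod_le_prod' fun i _ => hone i
    _ = ENNReal.ofReal (Real.exp (-p * n)) := by
        rw [Finset.prod_const, Finset.card_univ, Fintype.card_fin,
          ← ENNReal.ofReal_pow (Real.exp_pos _).le, ← Real.exp_nat_mul]
        congr 2
        ring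

end BoundaryUniform

/-! ### Empty caps and the radius of stabilization -/

section Stabilization

/-- If the radius of stabilization is at least `r`, some half-space with `x` on its boundary
contains none of the points in its interior, but reaches a point of `K` far away from `x`. -/
theorem exists_empty_cap_of_le_stabilizationRadius {d : ℕ}
    {K : ConvexBody (EuclideanSpace ℝ (Fin d))} {x : EuclideanSpace ℝ (Fin d)}
    {A : Set (EuclideanSpace ℝ (Fin d))} {r : ℝ} (hr : 0 < r)
    (h : r ≤ stabilizationRadius K x A) :
    ∃ u : EuclideanSpace ℝ (Fin d), u ≠ 0 ∧
      (∃ y ∈ (K : Set (EuclideanSpace ℝ (Fin d))), r / 2 < ‖y - x‖ ∧ ⟪u, x⟫ ≤ ⟪u, y⟫) ∧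
      ∀ w ∈ A, ⟪u, w⟫ ≤ ⟪u, x⟫ := by
  by_contra! hno
  have hle : stabilizationRadius K x A ≤ r / 2 := by
    refine csInf_le ⟨0, fun R hR => hR.1.le⟩ ⟨half_pos hr, ?_⟩
    rintro F - hxF H ⟨u, t, hu, rfl, hF, hPH⟩ y ⟨hyK, hyH⟩
    have hxt : ⟪u, x⟫ = t := by
      have : x ∈ (affineSpan ℝ F : Set (EuclideanSpace ℝ (Fin d))) := subset_affineSpan ℝ F hxF
      rwa [hF] at this
    rw [Metric.mem_closedBall, dist_eq_norm]
    by_contra! hfar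
    obtain ⟨w, hw, hlt⟩ := hno u hu ⟨y, hyK, hfar, hxt.trans_le hyH⟩
    have hwt : ⟪u, w⟫ = t := hPH ⟨subset_convexHull ℝ A hw, (hxt ▸ hlt).le⟩
    linarith
  linarith

variable {m : ℕ}

local notation "𝔼" => EuclideanSpace ℝ (Fin (m + 1))

/-- The sets that detect a large radius of stabilization: boundary points in balls whose radius is
proportional to the dyadic scale `2 ^ k * r`, centred at the points of a rescaled net `T`. The
number of sets at each scale is independent of `x`, `r` and `k`, and one of those that the sample
misses has uniform measure of order `(2 ^ k * r) ^ m`. -/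
theorem exists_detecting_balls (K : ConvexBody 𝔼) (hK : IsC2Plus K) :
    ∃ q : ℝ, ∃ T : Finset 𝔼, ∃ κ > 0, ∀ x ∈ frontier (K : Set 𝔼), ∀ r : ℝ, 0 < r →
      ∀ A : Set 𝔼, r ≤ stabilizationRadius K x A →
        ∃ k : ℕ, ∃ c ∈ T,
          ENNReal.ofReal (κ * (2 ^ k * r) ^ m) ≤ boundaryUniform K
            (Metric.ball (x + (2 ^ k * r) • c) (q * (2 ^ k * r)) ∩ frontier (K : Set 𝔼)) ∧
          ∀ w ∈ A, w ∉
            Metric.ball (x + (2 ^ k * r) • c) (q * (2 ^ k * r)) ∩ frontier (K : Set 𝔼) := by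
  obtain ⟨q, hq, hcap⟩ := exists_ball_inter_frontier_subset_cap K hK
  obtain ⟨κ, hκ, hlow⟩ := exists_le_boundaryUniform_ball K hK.1 one_pos
  obtain ⟨T, -, hTfin, hT⟩ :=
    (isCompact_closedBall (0 : 𝔼) 1).finite_cover_balls (e := q / 16) (by positivity)
  refine ⟨q / 8, hTfin.toFinset, κ * (q / 16) ^ m, by positivity, fun x hx r hr A hA => ?_⟩
  obtain ⟨u, hu, ⟨y, hy, hyr, hxy⟩, hAu⟩ := exists_empty_cap_of_le_stabilizationRadius hr hA
  have hyx : y ≠ x := by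
    rintro rfl
    simp at hyr
    linarith
  obtain ⟨z, hz, s, hys, hzs, hsq, hw⟩ := hcap x (K.isClosed.frontier_subset hx) y hy hyx u hu hxy
  have hsr : r / 4 < s := by linarith
  have hs0 : 0 < s := by linarith
  obtain ⟨k, hk1, hk2⟩ := exists_nat_pow_near (x := s / (r / 4)) (y := 2)
    ((one_le_div (by positivity)).2 hsr.le) one_lt_two
  rw [le_div_iff₀ (by positivity)] at hk1
  rw [div_lt_iff₀ (by positivity), pow_succ] at hk2
  -- `R` is the dyadic scale; it satisfies `s ≤ R ≤ 4 * s`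
  set R := 2 ^ k * r with hR
  have hR0 : 0 < R := by positivity
  have hzR : ‖R⁻¹ • (z - x)‖ ≤ 1 := by
    rw [norm_smul, norm_inv, Real.norm_eq_abs, abs_of_pos hR0, inv_mul_le_iff₀ hR0]
    linarith
  obtain ⟨c, hcT, hc⟩ := Set.mem_iUnion₂.1 (hT (by simpa using hzR : R⁻¹ • (z - x) ∈ _))
  have hzc : dist z (x + R • c) < R * (q / 16) := by
    rw [Metric.mem_ball, dist_eq_norm] at hc
    rw [dist_eq_norm, show z - (x + R • c) = R • (R⁻¹ • (z - x) - c) by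
      rw [smul_sub, smul_inv_smul₀ hR0.ne']; abel, norm_smul, Real.norm_eq_abs, abs_of_pos hR0]
    exact mul_lt_mul_of_pos_left hc hR0
  have hqs : q * s ≤ 1 := by
    rw [le_div_iff₀ hq] at hsq
    linarith
  have hRq : R * q ≤ 4 * (q * s) := by nlinarith
  refine ⟨k, c, by simpa using hcT, ?_, ?_⟩
  · calc ENNReal.ofReal (κ * (q / 16) ^ m * R ^ m)
        = ENNReal.ofReal (κ * (R * (q / 16)) ^ m) := by
          rw [mul_pow]; congr 1; ring
      _ ≤ boundaryUniform K (Metric.ball z (R * (q / 16)) ∩ frontier (K : Set 𝔼)) :=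
          hlow z hz _ (by positivity) (by linarith)
      _ ≤ _ := by
          refine measure_mono (Set.inter_subset_inter_left _ (Metric.ball_subset_ball' ?_))
          linarith
  · rintro w hwA ⟨hwb, hwf⟩
    refine (hAu w hwA).not_gt (hw w hwf ?_)
    rw [← dist_eq_norm]
    rw [Metric.mem_ball] at hwb
    have := dist_triangle_right w z (x + R • c)
    have hqs0 : 0 < q * s := by positivity
    linarith

theorem sum_exp_dyadic_le {v : ℝ} (hv : 1 ≤ v) {m : ℕ} (hm : m ≠ 0) (N : ℕ) :
    ∑' k : ℕ, (N : ENNReal) * ENNReal.ofReal (Real.exp (-v * (2 ^ k) ^ m)) ≤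
      ENNReal.ofReal (2 * N * Real.exp (-v)) := by
  have hhalf : Real.exp (-v) ≤ 1 / 2 := by
    rw [Real.exp_neg, ← one_div]
    gcongr
    linarith [Real.add_one_le_exp v]
  have hterm : ∀ k : ℕ, (N : ENNReal) * ENNReal.ofReal (Real.exp (-v * (2 ^ k) ^ m)) ≤
      ENNReal.ofReal (N * Real.exp (-v) * (1 / 2) ^ k) := by
    intro k
    rw [← ENNReal.ofReal_natCast, ← ENNReal.ofReal_mul (by positivity)]
    refine ENNReal.ofReal_le_ofReal ?_
    have hk : ((k : ℝ) + 1) ≤ (2 ^ k) ^ m := by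
      calc ((k : ℝ) + 1) ≤ 2 ^ k := by exact_mod_cast Nat.lt_two_pow_self (n := k)
        _ ≤ (2 ^ k) ^ m := le_self_pow₀ (one_le_pow₀ one_le_two) hm
    rw [mul_assoc]
    gcongr
    calc Real.exp (-v * (2 ^ k) ^ m) ≤ Real.exp (-v + k * -v) := by
          apply Real.exp_le_exp.2
          nlinarith
      _ = Real.exp (-v) * Real.exp (-v) ^ k := by rw [Real.exp_add, Real.exp_nat_mul]
      _ ≤ Real.exp (-v) * (1 / 2) ^ k := by gcongr
  refine (ENNReal.tsum_le_tsum hterm).trans_eq ?_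
  rw [← ENNReal.ofReal_tsum_of_nonneg (fun k => by positivity)
    (summable_geometric_two.mul_left _), tsum_mul_left, tsum_geometric_two]
  congr 1
  ring

end Stabilization

/-! ### The tail estimate -/

theorem mainTheorem4 (d : ℕ) (hd : 2 ≤ d) (K : ConvexBody (EuclideanSpace ℝ (Fin d)))
    (hK : IsC2Plus K) :
    ∃ c : ℝ, 0 < c ∧ ∃ C : ℝ, 0 < C ∧
      ∀ x ∈ frontier (K : Set (EuclideanSpace ℝ (Fin d))), ∀ r : ℝ, 0 < r → ∀ n : ℕ,
        ∀ (Ω : Type*) [MeasurableSpace Ω] (P : Measure Ω) [IsProbabilityMeasure P]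
          (X : Fin n → Ω → EuclideanSpace ℝ (Fin d)),
          iIndepFun X P → (∀ i, HasLaw (X i) (boundaryUniform K) P) →
            P.real {ω | r ≤ stabilizationRadius K x (Set.range (fun i => X i ω) ∪ {x})} ≤
              C * Real.exp (-c * r ^ (d - 1) * n) := by
  obtain ⟨m, rfl⟩ : ∃ m, d = m + 1 := ⟨d - 1, by omega⟩
  have hm : m ≠ 0 := by omega
  obtain ⟨q, T, κ, hκ, hdet⟩ := exists_detecting_balls K hK
  refine ⟨κ, hκ, 2 * T.card + 3, by positivity, fun x hx r hr n Ω _ P _ X hX hlaw => ?_⟩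
  simp only [Nat.add_sub_cancel]
  set v := κ * r ^ m * n with hv
  rw [show -κ * r ^ m * n = -v by rw [hv]; ring]
  rcases lt_or_ge v 1 with hv1 | hv1
  · -- here the right-hand side exceeds one, because `3 * exp (-1) ≥ 1`
    refine measureReal_le_one.trans ?_
    have h1 : Real.exp (-1) ≤ Real.exp (-v) := Real.exp_le_exp.2 (by linarith)
    have h2 : 1 ≤ 3 * Real.exp (-1) := by
      rw [Real.exp_neg, ← div_eq_mul_inv, one_le_div (Real.exp_pos 1)]
      exact Real.exp_one_lt_three.le
    have h3 : 0 ≤ (T.card : ℝ) * Real.exp (-v) := by positivity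
    nlinarith
  · let D : ℕ → EuclideanSpace ℝ (Fin (m + 1)) → Set (EuclideanSpace ℝ (Fin (m + 1))) :=
      fun k c => Metric.ball (x + (2 ^ k * r) • c) (q * (2 ^ k * r)) ∩
        frontier (K : Set (EuclideanSpace ℝ (Fin (m + 1))))
    let B : ℕ → EuclideanSpace ℝ (Fin (m + 1)) → Set Ω := fun k c =>
      {ω | ENNReal.ofReal (κ * (2 ^ k * r) ^ m) ≤ boundaryUniform K (D k c) ∧ ∀ i, X i ω ∉ D k c}
    have hsub : {ω | r ≤ stabilizationRadius K x (Set.range (fun i => X i ω) ∪ {x})} ⊆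
        ⋃ k, ⋃ c ∈ T, B k c := by
      intro ω hω
      obtain ⟨k, c, hc, h1, h2⟩ := hdet x hx r hr _ hω
      simp only [Set.mem_iUnion]
      exact ⟨k, c, hc, h1, fun i => h2 _ (Or.inl ⟨i, rfl⟩)⟩
    have hB : ∀ k c, P (B k c) ≤ ENNReal.ofReal (Real.exp (-v * (2 ^ k) ^ m)) := by
      intro k c
      by_cases hp : ENNReal.ofReal (κ * (2 ^ k * r) ^ m) ≤ boundaryUniform K (D k c)
      · refine (measure_mono fun ω hω => hω.2).trans ((measure_forall_notMem_le_exp hX hlaw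
          (Metric.isOpen_ball.measurableSet.inter isClosed_frontier.measurableSet) hp).trans_eq ?_)
        congr 2
        rw [hv, mul_pow]
        ring
      · have : B k c = ∅ := Set.eq_empty_of_forall_notMem fun ω hω => hp hω.1
        simp [this]
    have hP : P {ω | r ≤ stabilizationRadius K x (Set.range (fun i => X i ω) ∪ {x})} ≤
        ENNReal.ofReal (2 * T.card * Real.exp (-v)) := by
      refine (measure_mono hsub).trans ((measure_iUnion_le _).trans
        (le_trans (ENNReal.tsum_le_tsum fun k => ?_) (sum_exp_dyadic_le hv1 hm T.card)))
      refine (measure_biUnion_finset_le T _).trans ((Finset.sum_le_sum fun c _ => hB k c).trans_eq ?_)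
      rw [Finset.sum_const, nsmul_eq_mul]
    refine (ENNReal.toReal_le_of_le_ofReal (by positivity) hP).trans ?_
    gcongr
    linarith
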